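/- Throughout, a quantum system $A$ is a tensor product of finitely many qudits whose dimensions $d_i$ are odd primes, and $d_A=\prod_i d_i$. For one qudit of dimension $d$ let $X|j\rangle=|j+1 \bmod d\rangle$, $Z|j\rangle=e^{2\pi i j/d}|j\rangle$, $\tau=e^{(d+1)\pi i/d}$ and $T_{(a_1,a_2)}=\tau^{-a_1a_2}Z^{a_1}X^{a_2}$ for $(a_1,a_2)\in\mathbb Z_d\times\mathbb Z_d$; for a general system the operators $T_{\mathbf u}$ are the tensor products of those of its qudits, indexed by the points $\mathbf u$ of the product phase space. The phase-space point operators are $A_{\mathbf 0}=\frac1{d_A}\sum_{\mathbf u}T_{\mathbf u}$ and $A_{\mathbf u}=T_{\mathbf u}A_{\mathbf 0}T_{\mathbf u}^\dagger$, written $A_A^{\mathbf u}$ for the system $A$. All logarithms are to base $2$, with $\log 0=-\infty$, and $\le$ between operators is the Loewner order. For a completely positive map $\mathcal E$ from operators on $A$ to operators on $B$ put $$\mathcal M(\mathcal E)=\log\max_{\mathbf u}\sum_{\mathbf v}\frac1{d_B}\bigl|\operatorname{tr}[A_B^{\mathbf v}\,\mathcal E(A_A^{\mathbf u})]\bigr|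 .$$ Let $D_{\max}(\rho\|\sigma)=\inf\{\lambda\in\mathbb R:\rho\le 2^\lambda\sigma\}$ (with $\inf\emptyset=+\infty$), and let $$D_{\max}(\mathcal N\|\mathcal E)=\sup_{\psi_{RA}}D_{\max}\bigl((\mathrm{id}_R\otimes\mathcal N)(\psi_{RA})\,\big\|\,(\mathrm{id}_R\otimes\mathcal E)(\psi_{RA})\bigr),$$ where the supremum is over all pure states $\psi_{RA}$ with $R$ isomorphic to $A$. The max-thauma of a quantum channel (completely positive trace-preserving map) $\mathcal N_{A\to B}$ is $$\theta_{\max}(\mathcal N)=\min\{D_{\max}(\mathcal N\|\mathcal E):\ \mathcal E_{A\to B}\text{ completely positive},\ \mathcal M(\mathcal E)\le 0\}.$$ Let $J^{\mathcal N}_{AB}=\sum_{i,j}|i\rangle\langle j|_A\otimes\mathcal N(|i\rangle\langle j|)$ be the Choi–Jamiołkowski matrix of $\mathcal N$. **Proposition (SDP for max-thauma).** For every quantum channel $\mathcal N_{A\to B}$, the minimum defining $\theta_{\max}(\mathcal N)$ is attained, and $$\theta_{\max}(\mathcal N)=\log\ \min_{t,\,Y_{AB}}\ t\quad\text{s.t.}\quad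 J^{\mathcal N}_{AB}\le Y_{AB},\qquad \sum_{\mathbf v}\bigl|\operatorname{tr}[(A_A^{\mathbf u}\otimes A_B^{\mathbf v})Y_{AB}]\bigr|/d_B\le t\quad\forall\,\mathbf u .$$ Moreover the dual SDP has the same value: $\theta_{\max}(\mathcal N)=\log\ \max\ \operatorname{tr}[J^{\mathcal N}_{AB}V_{AB}]$, where the maximum is over operators $V_{AB}$ and real numbers $b_{\mathbf v},c_{\mathbf v,\mathbf u},f_{\mathbf v,\mathbf u}$ (with $\mathbf v$ in the phase space of $A$ and $\mathbf u$ in that of $B$) subject to $$\sum_{\mathbf v}b_{\mathbf v}\le 1,\qquad 0\le V_{AB}\le\sum_{\mathbf v,\mathbf u}(c_{\mathbf v,\mathbf u}-f_{\mathbf v,\mathbf u})\,A_A^{\mathbf v}\otimes A_B^{\mathbf u}/d_B,$$ $$c_{\mathbf v,\mathbf u}+f_{\mathbf v,\mathbf u}\le b_{\mathbf v},\quad c_{\mathbf v,\mathbf u}\ge 0,\quad f_{\mathbf v,\mathbf u}\ge 0\qquad\forall\,\mathbf u,\mathbf v .$$ Both the minimum and the maximum are attained, and their common value is positive. -/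

import Mathlib

open scoped Matrix Kronecker ComplexOrder MatrixOrder

noncomputable section

namespace QuditMagic

/-- A quantum system: a tensor product of finitely many qudits, each of odd prime dimension.
The empty product is the trivial one-dimensional system. -/
structure QuditSystem where
  numQudits : ℕ
  dim : Fin numQudits → ℕ
  prime_dim : ∀ i, (dim i).Prime
  odd_dim : ∀ i, Odd (dim i)

namespace QuditSystem

instance instNeZeroDim (S : QuditSystem) (i : Fin S.numQudits) : NeZero (S.dim i) :=
  ⟨(S.prime_dim i).ne_zero⟩

/-- Labels of the computational basis of the Hilbert space of `S`. -/
abbrev Basis (S : QuditSystem) : Type := ∀ i : Fin S.numQudits, ZMod (S.dim i)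

/-- The discrete phase space of `S`. -/
abbrev Phase (S : QuditSystem) : Type :=
  ∀ i : Fin S.numQudits, ZMod (S.dim i) × ZMod (S.dim i)

/-- The dimension of the Hilbert space of `S`. -/
def hilbertDim (S : QuditSystem) : ℕ := ∏ i, S.dim i

/-- Linear operators on the Hilbert space of `S`, in the computational basis. -/
abbrev Op (S : QuditSystem) : Type := Matrix S.Basis S.Basis ℂ

end QuditSystem

/-- The shift operator `X |j⟩ = |j + 1⟩`. -/
def shiftX (d : ℕ) : Matrix (ZMod d) (ZMod d) ℂ :=
  Matrix.of fun i j => if i = j + 1 then 1 else 0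

/-- The boost operator `Z |j⟩ = ω ^ j |j⟩` with `ω = exp (2 π i / d)`. -/
def boostZ (d : ℕ) : Matrix (ZMod d) (ZMod d) ℂ :=
  Matrix.diagonal fun j => Complex.exp (2 * Real.pi * Complex.I / d) ^ j.val

/-- The single-qudit operator `τ ^ (- a₁ a₂) Z ^ a₁ X ^ a₂`, where
`τ = exp ((d + 1) π i / d)`. The exponents may be taken to be representatives of the residue
classes, since `τ ^ d = 1` for odd `d`. -/
def heisenbergWeyl₁ (d : ℕ) [NeZero d] (u : ZMod d × ZMod d) : Matrix (ZMod d) (ZMod d) ℂ :=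
  (Complex.exp ((d + 1) * Real.pi * Complex.I / d) ^ (-((u.1.val * u.2.val : ℕ) : ℤ))) •
    (boostZ d ^ u.1.val * shiftX d ^ u.2.val)

/-- The Heisenberg--Weyl operator `T_u` of a system: the tensor product of the operators
of its qudits. -/
def heisenbergWeyl (S : QuditSystem) (u : S.Phase) : S.Op :=
  Matrix.of fun x y => ∏ i, heisenbergWeyl₁ (S.dim i) (u i) (x i) (y i)

/-- The phase-space point operator at the origin, `A_0 = (1 / d) ∑ u, T_u`. -/
def phasePointZero (S : QuditSystem) : S.Op :=
  (1 / (S.hilbertDim : ℂ)) • ∑ u : S.Phase, heisenbergWeyl S u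

/-- The phase-space point operator `A_u = T_u A_0 T_u†`. -/
def phasePoint (S : QuditSystem) (u : S.Phase) : S.Op :=
  heisenbergWeyl S u * phasePointZero S * (heisenbergWeyl S u)ᴴ

/-- The discrete Wigner function `W_V(u) = tr[A_u V] / d`. -/
def wigner (S : QuditSystem) (V : S.Op) (u : S.Phase) : ℂ :=
  (phasePoint S u * V).trace / (S.hilbertDim : ℂ)

/-- The Wigner trace norm `‖V‖_{W,1} = ∑ u, |W_V(u)|`. -/
def wignerTraceNorm (S : QuditSystem) (V : S.Op) : ℝ :=
  ∑ u : S.Phase, ‖wigner S V u‖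

/-- The base-two logarithm of a non-negative real number, with value `-∞` at `0`. -/
def log₂ (x : ℝ) : EReal := if x ≤ 0 then ⊥ else (Real.logb 2 x : EReal)

/-- The amplification `id_R ⊗ N` of a linear map `N`. -/
def amplify {α β : Type*} (R : Type*) (N : Matrix α α ℂ →ₗ[ℂ] Matrix β β ℂ)
    (M : Matrix (R × α) (R × α) ℂ) : Matrix (R × β) (R × β) ℂ :=
  Matrix.of fun p q => N (Matrix.of fun a a' => M (p.1, a) (q.1, a')) p.2 q.2

/-- Complete positivity: every amplification preserves positive semidefiniteness. -/
def IsCompletelyPositive {α β : Type*} (N : Matrix α α ℂ →ₗ[ℂ] Matrix β β ℂ) : Prop :=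
  ∀ (k : ℕ) (M : Matrix (Fin k × α) (Fin k × α) ℂ),
    M.PosSemidef → (amplify (Fin k) N M).PosSemidef

/-- A quantum channel: a completely positive trace-preserving linear map. -/
def IsChannel {α β : Type*} [Fintype α] [Fintype β]
    (N : Matrix α α ℂ →ₗ[ℂ] Matrix β β ℂ) : Prop :=
  IsCompletelyPositive N ∧ ∀ M, (N M).trace = M.trace

/-- The Choi--Jamiolkowski matrix `J^N = ∑ i j, |i⟩⟨j| ⊗ N(|i⟩⟨j|)`. -/
def choi {α β : Type*} [Fintype α] [DecidableEq α]
    (N : Matrix α α ℂ →ₗ[ℂ] Matrix β β ℂ) : Matrix (α × β) (α × β) ℂ :=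
  ∑ i, ∑ j, Matrix.single i j (1 : ℂ) ⊗ₖ N (Matrix.single i j 1)

/-- The mana of a linear map, `log₂ (max_u ‖N(A_u)‖_{W,1})`. -/
def mana (A B : QuditSystem) (N : A.Op →ₗ[ℂ] B.Op) : EReal :=
  log₂ (Finset.univ.sup' Finset.univ_nonempty
    fun u : A.Phase => wignerTraceNorm B (N (phasePoint A u)))

/-- The max-relative entropy `inf {r : ρ ≤ 2 ^ r σ}`, which is `+∞` if no such `r` exists. -/
def maxRelEntropy {α : Type*} [Fintype α] (ρ σ : Matrix α α ℂ) : EReal :=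
  sInf ((fun r : ℝ => (r : EReal)) '' {r : ℝ | ρ ≤ ((2 : ℝ) ^ r) • σ})

/-- The max-divergence of two linear maps: the supremum of the max-relative entropy of the
outputs over all pure input states `|ψ⟩⟨ψ|_{RA}`, where `R` is isomorphic to `A`. -/
def maxChannelDivergence {α β : Type*} [Fintype α] [Fintype β]
    (N E : Matrix α α ℂ →ₗ[ℂ] Matrix β β ℂ) : EReal :=
  ⨆ ψ : {ψ : α × α → ℂ // star ψ ⬝ᵥ ψ = 1},
    maxRelEntropy (amplify α N (Matrix.vecMulVec ψ.1 (star ψ.1)))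
      (amplify α E (Matrix.vecMulVec ψ.1 (star ψ.1)))

/-- The competitors in the definition of the max-thauma: completely positive maps of
non-positive mana. -/
def subMagicMaps (A B : QuditSystem) : Set (A.Op →ₗ[ℂ] B.Op) :=
  {E | IsCompletelyPositive E ∧ mana A B E ≤ 0}

/-- The max-thauma of a map. -/
def maxThauma (A B : QuditSystem) (N : A.Op →ₗ[ℂ] B.Op) : EReal :=
  ⨅ E : subMagicMaps A B, maxChannelDivergence N E.1

/-- The objective values `t` of the feasible points `(t, Y)` of the primal program. -/
def primalValues (A B : QuditSystem) (N : A.Op →ₗ[ℂ] B.Op) : Set ℝ :=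
  {t | ∃ Y : Matrix (A.Basis × B.Basis) (A.Basis × B.Basis) ℂ,
    choi N ≤ Y ∧
    ∀ u : A.Phase,
      (∑ v : B.Phase, ‖((phasePoint A u ⊗ₖ phasePoint B v) * Y).trace‖) / (B.hilbertDim : ℝ)
        ≤ t}

/-- The objective values `s = tr[J^N V]` of the feasible points `(V, b, c, f)` of the dual
program. -/
def dualValues (A B : QuditSystem) (N : A.Op →ₗ[ℂ] B.Op) : Set ℝ :=
  {s | ∃ (V : Matrix (A.Basis × B.Basis) (A.Basis × B.Basis) ℂ)
      (b : A.Phase → ℝ) (c f : A.Phase → B.Phase → ℝ),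
    ∑ v, b v ≤ 1 ∧
    0 ≤ V ∧
    V ≤ ∑ v, ∑ u, ((c v u - f v u) / (B.hilbertDim : ℝ)) • (phasePoint A v ⊗ₖ phasePoint B u) ∧
    (∀ v u, c v u + f v u ≤ b v) ∧
    (∀ v u, 0 ≤ c v u) ∧
    (∀ v u, 0 ≤ f v u) ∧
    (choi N * V).trace = (s : ℂ)}

end QuditMagic

end

/-! The operators `A_u ⊗ A_v` are Hermitian, orthogonal for the trace inner product and complete
(`isHermitianFrame_phasePoint`), so a Hermitian `Y` amounts to the array of real coordinates
`tr[(A_u ⊗ A_v) Y]`. In these coordinates the primal program minimises a mixed `(∞, 1)`-norm,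
`rowNorm`, over the closed convex set `J ≤ Y`. Sublevel sets of the norm are compact, so the minimum
`t` is attained; it is positive because `0 ≤ J ≠ 0`. The open ball of radius `t` misses the feasible
set, and a separating functional, suitably rescaled, is an optimal dual point: `V` is positive
because the feasible set is stable under adding positive operators, and the constraints on `b`, `c`,
`f` express that the functional has dual norm at most one (`IsHermitianFrame.strong_duality`).

The max-thauma reduces to this program because the channel divergence is governed by Choi matrices,
as the infimum of the `r` with `J^N ≤ 2 ^ r J^E` (`maxChannelDivergence_le`,
`le_maxChannelDivergence`), while non-positive mana is the row constraint on `J^E` with bound `1`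
(`mana_le_zero_iff`). The substitution `Y = 2 ^ r J^E` passes from maps to feasible points, and `J^E
= Y / t` passes back. -/

namespace QuditMagic

/-! ### Matrix elements and character sums for one qudit. -/

section SingleQudit

variable {d : ℕ} [NeZero d]

lemma shiftX_pow_apply (n : ℕ) (i j : ZMod d) :
    (shiftX d ^ n) i j = if i = j + n then 1 else 0 := by
  induction n generalizing i j with
  | zero => simp [Matrix.one_apply]
  | succ n ih =>
    have h1 : ∀ k, shiftX d k j = if k = j + 1 then 1 else 0 := fun _ => rfl
    rw [pow_succ, Matrix.mul_apply]
    simp only [ih, h1, mul_ite, mul_one, mul_zero, Finset.sum_ite_eq', Finset.mem_univ, if_true]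
    simp [add_assoc, add_comm (1 : ZMod d)]

lemma exp_eq_stdAddChar_one :
    Complex.exp (2 * Real.pi * Complex.I / d) = ZMod.stdAddChar (1 : ZMod d) := by
  have := ZMod.stdAddChar_coe (N := d) 1
  simpa using this.symm

lemma exp_eq_stdAddChar_half (hd : Odd d) :
    Complex.exp ((d + 1) * Real.pi * Complex.I / d)
      = ZMod.stdAddChar (((d + 1) / 2 : ℕ) : ZMod d) := by
  have h := ZMod.stdAddChar_coe (N := d) (((d + 1) / 2 : ℕ) : ℤ)
  rw [Int.cast_natCast] at h
  rw [h]
  obtain ⟨k, rfl⟩ := hd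
  have : (2 * k + 1 + 1) / 2 = k + 1 := by omega
  rw [this]
  push_cast
  ring_nf

lemma half_mul_two (hd : Odd d) : (((d + 1) / 2 : ℕ) : ZMod d) * 2 = 1 := by
  obtain ⟨k, rfl⟩ := hd
  have h : (2 * k + 1 + 1) / 2 = k + 1 := by omega
  have h0 : ((2 * k + 1 : ℕ) : ZMod (2 * k + 1)) = 0 := ZMod.natCast_self _
  rw [h]
  push_cast at h0 ⊢
  linear_combination h0

lemma isUnit_two (hd : Odd d) : IsUnit (2 : ZMod d) :=
  IsUnit.of_mul_eq_one _ ((mul_comm _ _).trans (half_mul_two hd))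

/-- Since `τ = ω ^ ((d + 1) / 2)` and `(d + 1) / 2` is the inverse of `2` modulo `d`, all phases
combine into one additive character of `ZMod d`. -/
lemma heisenbergWeyl₁_apply (hd : Odd d) (u : ZMod d × ZMod d) (x y : ZMod d) :
    heisenbergWeyl₁ d u x y = if x = y + u.2 then
      ZMod.stdAddChar (u.1 * (x - u.2 * (((d + 1) / 2 : ℕ) : ZMod d))) else 0 := by
  have hx : ((x.val : ℕ) : ZMod d) = x := ZMod.natCast_zmod_val x
  have h1 : ((u.1.val : ℕ) : ZMod d) = u.1 := ZMod.natCast_zmod_val _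
  have h2 : ((u.2.val : ℕ) : ZMod d) = u.2 := ZMod.natCast_zmod_val _
  rw [heisenbergWeyl₁, Matrix.smul_apply, boostZ, Matrix.diagonal_pow, Matrix.diagonal_mul,
    shiftX_pow_apply, exp_eq_stdAddChar_half hd, exp_eq_stdAddChar_one, h2]
  split_ifs
  · rw [Pi.pow_apply, mul_one, zpow_neg, zpow_natCast, ← pow_mul, ← AddChar.map_nsmul_eq_pow,
      ← AddChar.map_nsmul_eq_pow, ← AddChar.map_neg_eq_inv, smul_eq_mul, ← AddChar.map_add_eq_mul]
    congr 1
    simp only [nsmul_eq_mul, Nat.cast_mul, hx, h1, h2]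
    ring
  · simp

lemma sum_stdAddChar_mul (b : ZMod d) :
    ∑ a : ZMod d, ZMod.stdAddChar (a * b) = if b = 0 then (d : ℂ) else 0 := by
  have := AddChar.sum_mulShift b (ZMod.isPrimitive_stdAddChar d)
  rw [this, ZMod.card]
  split_ifs <;> simp

/-- The shift must be `x - y`; the sum over momenta is then a character sum at `(x + y) / 2`. Hence
`A_0` is the parity operator. -/
lemma sum_heisenbergWeyl₁_apply (hd : Odd d) (x y : ZMod d) :
    ∑ u, heisenbergWeyl₁ d u x y = if x + y = 0 then (d : ℂ) else 0 := by
  simp only [heisenbergWeyl₁_apply hd, Fintype.sum_prod_type]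
  have key : ∀ a b : ZMod d, x = y + b ↔ b = x - y := fun _ b =>
    ⟨fun h => by rw [h]; ring, fun h => by rw [h]; ring⟩
  simp only [key 0, Finset.sum_ite_eq', Finset.mem_univ, if_true]
  rw [sum_stdAddChar_mul]
  have h2 := half_mul_two hd
  refine if_congr ⟨fun h => ?_, fun h => ?_⟩ rfl rfl
  · linear_combination 2 * h + (x - y) * h2
  · linear_combination (((d + 1) / 2 : ℕ) : ZMod d) * h - x * h2

lemma star_stdAddChar (a : ZMod d) :
    star (ZMod.stdAddChar a : ℂ) = ZMod.stdAddChar (-a) := by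
  rw [AddChar.map_neg_eq_conj]; rfl

/-- The matrix elements of the phase-space point operators of one qudit. -/
noncomputable def phaseEntry (u : ZMod d × ZMod d) (x y : ZMod d) : ℂ :=
  if x + y = 2 * u.2 then ZMod.stdAddChar (u.1 * (x - y)) else 0

lemma heisenbergWeyl₁_conj_parity (hd : Odd d) (u : ZMod d × ZMod d) (x y : ZMod d) :
    ∑ z, heisenbergWeyl₁ d u x z * star (heisenbergWeyl₁ d u y (-z)) = phaseEntry u x y := by
  simp only [heisenbergWeyl₁_apply hd]
  rw [Finset.sum_eq_single (x - u.2) _ (by simp)]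
  · have h : y = -(x - u.2) + u.2 ↔ x + y = 2 * u.2 :=
      ⟨fun h => by rw [h]; ring, fun h => by linear_combination h⟩
    simp only [sub_add_cancel, if_true, h, phaseEntry]
    split_ifs
    · rw [star_stdAddChar, ← AddChar.map_add_eq_mul]
      congr 1; ring
    · simp
  · intro z _ hz
    rw [if_neg, zero_mul]
    exact fun h => hz (by rw [h]; ring)

lemma star_phaseEntry (u : ZMod d × ZMod d) (x y : ZMod d) :
    star (phaseEntry u x y) = phaseEntry u y x := by
  unfold phaseEntry
  rw [add_comm y x]
  split_ifs
  · rw [star_stdAddChar]; congr 1; ring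
  · simp

lemma phaseEntry_swap (u : ZMod d × ZMod d) (x y : ZMod d) :
    phaseEntry u y x = phaseEntry (-u.1, u.2) x y := by
  unfold phaseEntry
  rw [add_comm y x]
  refine if_congr Iff.rfl ?_ rfl
  congr 1; ring

lemma sum_phaseEntry_mul_phaseEntry (hd : Odd d) (x y k l : ZMod d) :
    ∑ u, phaseEntry u x y * phaseEntry u k l = if x = l ∧ y = k then (d : ℂ) else 0 := by
  have h2 := isUnit_two hd
  -- The midpoint `c` of `x` and `y` is the only position that contributes; the momentum sum then
  -- forces `x - y = l - k`.
  obtain ⟨c, hc⟩ : ∃ c, x + y = 2 * c := ⟨(((d + 1) / 2 : ℕ) : ZMod d) * (x + y), by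
    linear_combination (-(x + y)) * half_mul_two hd⟩
  simp only [Fintype.sum_prod_type_right, phaseEntry]
  rw [Finset.sum_eq_single c _ (by simp)]
  · simp only [hc, if_true]
    by_cases h : k + l = 2 * c
    · simp only [h, if_true, ← AddChar.map_add_eq_mul, ← mul_add]
      rw [sum_stdAddChar_mul]
      refine if_congr ⟨fun h' => ⟨h2.mul_left_cancel ?_, h2.mul_left_cancel ?_⟩, ?_⟩ rfl rfl
      · linear_combination h' + hc - h
      · linear_combination hc - h - h'
      · rintro ⟨rfl, rfl⟩; ring
    · rw [if_neg]
      · simp [h]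
      · rintro ⟨rfl, rfl⟩
        exact h (by rw [← hc]; ring)
  · intro b _ hb
    have : x + y ≠ 2 * b := fun h => hb (h2.mul_left_cancel (h.symm.trans hc))
    simp [this]

lemma sum_phaseEntry_mul_phaseEntry_swap (hd : Odd d) (u v : ZMod d × ZMod d) :
    ∑ x, ∑ y, phaseEntry u x y * phaseEntry v y x = if u = v then (d : ℂ) else 0 := by
  have h2 := isUnit_two hd
  simp only [phaseEntry]
  have key : ∀ x : ZMod d, ∑ y, ((if x + y = 2 * u.2 then ZMod.stdAddChar (u.1 * (x - y)) else 0)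
      * if y + x = 2 * v.2 then ZMod.stdAddChar (v.1 * (y - x)) else 0 : ℂ)
      = if u.2 = v.2 then ZMod.stdAddChar ((x - u.2) * (2 * (u.1 - v.1))) else 0 := by
    intro x
    rw [Finset.sum_eq_single (2 * u.2 - x) _ (by simp)]
    · simp only [add_sub_cancel, if_true, sub_add_cancel, h2.mul_right_inj]
      split_ifs
      · rw [← AddChar.map_add_eq_mul]; congr 1; ring
      · simp
    · intro y _ hy
      rw [if_neg, zero_mul]
      exact fun h => hy (by rw [← h]; ring)
  simp only [key]
  by_cases h : u.2 = v.2
  · simp only [h, if_true]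
    refine (Equiv.sum_comp (Equiv.subRight v.2)
      (fun x => (ZMod.stdAddChar (x * (2 * (u.1 - v.1))) : ℂ))).trans ?_
    rw [sum_stdAddChar_mul]
    simp [h2.mul_right_eq_zero, sub_eq_zero, Prod.ext_iff, h]
  · simp [h, Prod.ext_iff]

end SingleQudit

/-! ### Phase-space point operators of a composite system, factor by factor. -/

variable (S : QuditSystem)

lemma phasePointZero_apply (x y : S.Basis) :
    phasePointZero S x y = if y = -x then 1 else 0 := by
  have h : ∀ i, (S.dim i : ℂ) ≠ 0 := fun i => Nat.cast_ne_zero.2 (S.prime_dim i).ne_zero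
  rw [phasePointZero, Matrix.smul_apply, Matrix.sum_apply]
  simp only [heisenbergWeyl, Matrix.of_apply]
  rw [← Fintype.prod_sum (fun i (u : ZMod (S.dim i) × ZMod (S.dim i)) =>
    heisenbergWeyl₁ (S.dim i) u (x i) (y i))]
  simp only [sum_heisenbergWeyl₁_apply (S.odd_dim _)]
  rw [QuditSystem.hilbertDim, smul_eq_mul, Nat.cast_prod, one_div, ← Finset.prod_inv_distrib,
    ← Finset.prod_mul_distrib]
  have : (y = -x) ↔ ∀ i ∈ Finset.univ, x i + y i = 0 := by
    simp [funext_iff, eq_neg_iff_add_eq_zero, add_comm]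
  simp only [mul_ite, mul_zero, inv_mul_cancel₀ (h _)]
  rw [Finset.prod_ite_zero, Finset.prod_const_one]
  split_ifs <;> tauto

/-- The matrix elements of the phase-space point operators. -/
lemma phasePoint_apply (u : S.Phase) (x y : S.Basis) :
    phasePoint S u x y = ∏ i, phaseEntry (u i) (x i) (y i) := by
  rw [phasePoint, Matrix.mul_assoc, Matrix.mul_apply]
  have : ∀ z, (phasePointZero S * (heisenbergWeyl S u)ᴴ) z y = star (heisenbergWeyl S u y (-z)) := by
    intro z
    simp [Matrix.mul_apply, phasePointZero_apply]
  simp only [this]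
  simp only [heisenbergWeyl, Matrix.of_apply, star_prod, ← Finset.prod_mul_distrib,
    Pi.neg_apply]
  rw [← Fintype.prod_sum (fun i (z : ZMod (S.dim i)) => heisenbergWeyl₁ (S.dim i) (u i) (x i) z *
    star (heisenbergWeyl₁ (S.dim i) (u i) (y i) (-z)))]
  exact Finset.prod_congr rfl fun i _ => heisenbergWeyl₁_conj_parity (S.odd_dim i) _ _ _

lemma phasePoint_isHermitian (u : S.Phase) : (phasePoint S u).IsHermitian := by
  ext x y
  simp [Matrix.conjTranspose_apply, phasePoint_apply, ← star_phaseEntry (u _) (y _) (x _)]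

/-- The reflection of the phase space that changes the sign of all momenta. -/
def reflect : S.Phase ≃ S.Phase where
  toFun u i := (-(u i).1, (u i).2)
  invFun u i := (-(u i).1, (u i).2)
  left_inv u := by simp
  right_inv u := by simp

lemma phasePoint_transpose (u : S.Phase) :
    (phasePoint S u)ᵀ = phasePoint S (reflect S u) := by
  ext x y
  simp [phasePoint_apply, reflect, phaseEntry_swap (u _) (x _) (y _)]

lemma hilbertDim_pos : 0 < S.hilbertDim :=
  Finset.prod_pos fun i _ => (S.prime_dim i).pos

lemma sum_phasePoint_mul_phasePoint (x y k l : S.Basis) :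
    ∑ u, phasePoint S u x y * phasePoint S u k l
      = if x = l ∧ y = k then (S.hilbertDim : ℂ) else 0 := by
  simp only [phasePoint_apply, ← Finset.prod_mul_distrib]
  rw [← Fintype.prod_sum (fun i (u : ZMod (S.dim i) × ZMod (S.dim i)) =>
    phaseEntry u (x i) (y i) * phaseEntry u (k i) (l i))]
  simp only [sum_phaseEntry_mul_phaseEntry (S.odd_dim _)]
  have : (x = l ∧ y = k) ↔ ∀ i ∈ Finset.univ, x i = l i ∧ y i = k i := by
    simp [funext_iff, forall_and]
  rw [Finset.prod_ite_zero, QuditSystem.hilbertDim, Nat.cast_prod]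
  split_ifs <;> tauto

lemma trace_phasePoint_mul_phasePoint (u v : S.Phase) :
    (phasePoint S u * phasePoint S v).trace = if u = v then (S.hilbertDim : ℂ) else 0 := by
  simp only [Matrix.trace, Matrix.diag_apply, Matrix.mul_apply, phasePoint_apply,
    ← Finset.prod_mul_distrib]
  have h : ∀ x : S.Basis, ∑ y : S.Basis, ∏ i, phaseEntry (u i) (x i) (y i) *
      phaseEntry (v i) (y i) (x i) = ∏ i, ∑ y, phaseEntry (u i) (x i) y *
      phaseEntry (v i) y (x i) := fun x =>
    (Fintype.prod_sum (fun i (y : ZMod (S.dim i)) => phaseEntry (u i) (x i) y *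
      phaseEntry (v i) y (x i))).symm
  simp only [h]
  rw [← Fintype.prod_sum (fun i (x : ZMod (S.dim i)) => ∑ y, phaseEntry (u i) x y *
    phaseEntry (v i) y x)]
  simp only [sum_phaseEntry_mul_phaseEntry_swap (S.odd_dim _)]
  have : (u = v) ↔ ∀ i ∈ Finset.univ, u i = v i := by
    simp [funext_iff]
  rw [Finset.prod_ite_zero, QuditSystem.hilbertDim, Nat.cast_prod]
  split_ifs <;> tauto


/-! ### Traces of products of Hermitian and positive operators. -/

lemma ofReal_re_trace_mul {n : Type*} [Fintype n] {P Q : Matrix n n ℂ}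
    (hP : P.IsHermitian) (hQ : Q.IsHermitian) : ((P * Q).trace.re : ℂ) = (P * Q).trace := by
  rw [← Complex.conj_eq_iff_re]
  change star _ = _
  rw [← Matrix.trace_conjTranspose, Matrix.conjTranspose_mul, hP.eq, hQ.eq, Matrix.trace_mul_comm]

lemma dotProduct_mulVec_eq_trace {n : Type*} [Fintype n] (M : Matrix n n ℂ) (x : n → ℂ) :
    star x ⬝ᵥ (M *ᵥ x) = (Matrix.vecMulVec x (star x) * M).trace := by
  rw [Matrix.trace_mul_comm, Matrix.mul_vecMulVec, Matrix.trace_vecMulVec, dotProduct_comm]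

lemma trace_mul_nonneg_of_nonneg {n : Type*} [Fintype n] {P Q : Matrix n n ℂ}
    (hP : 0 ≤ P) (hQ : 0 ≤ Q) : 0 ≤ (P * Q).trace := by
  classical
  obtain ⟨R, rfl⟩ := CStarAlgebra.nonneg_iff_eq_star_mul_self.mp hQ
  rw [← Matrix.mul_assoc, Matrix.trace_mul_comm, ← Matrix.mul_assoc]
  exact ((Matrix.nonneg_iff_posSemidef.1 hP).mul_mul_conjTranspose_same R).trace_nonneg

/-! ### Conic duality for the mixed norm in a Hermitian operator basis. -/

section Duality

variable {κ μ n : Type*} [Fintype κ] [Fintype μ] [Fintype n]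

/-- A Hermitian operator basis `G` that is orthogonal for the trace inner product, with
`tr[G_p G_p] = D`. -/
structure IsHermitianFrame (G : κ → μ → Matrix n n ℂ) (D : ℝ) : Prop where
  pos : 0 < D
  isHermitian : ∀ p q, (G p q).IsHermitian
  trace_self : ∀ p q, (G p q * G p q).trace = D
  trace_of_ne : ∀ p q p' q', (p, q) ≠ (p', q') → (G p q * G p' q').trace = 0
  complete : ∀ M : Matrix n n ℂ, ∑ p, ∑ q, (G p q * M).trace • G p q = (D : ℂ) • M

/-- The operator with coordinates `y` with respect to the frame `G`. -/
noncomputable def frameOp (G : κ → μ → Matrix n n ℂ) (D : ℝ) :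
    (κ → μ → ℝ) →ₗ[ℝ] Matrix n n ℂ where
  toFun y := ∑ p, ∑ q, (y p q / D) • G p q
  map_add' y z := by
    simp only [Pi.add_apply, add_div, add_smul, Finset.sum_add_distrib]
  map_smul' c y := by
    simp only [Pi.smul_apply, smul_eq_mul, mul_div_assoc, mul_smul, Finset.smul_sum,
      RingHom.id_apply]

/-- The primal objective in coordinates. -/
noncomputable def rowNorm [Nonempty κ] (d : ℝ) (y : κ → μ → ℝ) : ℝ :=
  Finset.univ.sup' Finset.univ_nonempty fun p => (∑ q, |y p q|) / d

lemma rowNorm_le_iff [Nonempty κ] {d t : ℝ} {y : κ → μ → ℝ} :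
    rowNorm d y ≤ t ↔ ∀ p, (∑ q, |y p q|) / d ≤ t := by
  simp [rowNorm]

lemma rowNorm_lt_iff [Nonempty κ] {d t : ℝ} {y : κ → μ → ℝ} :
    rowNorm d y < t ↔ ∀ p, (∑ q, |y p q|) / d < t := by
  simp [rowNorm]

lemma continuous_rowNorm [Nonempty κ] (d : ℝ) :
    Continuous (rowNorm d : (κ → μ → ℝ) → ℝ) := by
  unfold rowNorm
  refine Continuous.finset_sup'_apply _ fun p _ => ?_
  fun_prop

lemma abs_le_of_rowNorm_le [Nonempty κ] {d t : ℝ} (hd : 0 < d) {y : κ → μ → ℝ}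
    (h : rowNorm d y ≤ t) (p : κ) (q : μ) : |y p q| ≤ t * d := by
  have := (div_le_iff₀ hd).1 (rowNorm_le_iff.1 h p)
  exact (Finset.single_le_sum (f := fun q => |y p q|) (fun _ _ => abs_nonneg _)
    (Finset.mem_univ q)).trans this

lemma isCompact_rowNorm_le [Nonempty κ] {d : ℝ} (hd : 0 < d) (t : ℝ) :
    IsCompact {y : κ → μ → ℝ | rowNorm d y ≤ t} := by
  refine Metric.isCompact_of_isClosed_isBounded
    (isClosed_le (continuous_rowNorm d) continuous_const) ?_
  refine (Metric.isBounded_closedBall (x := 0) (r := |t * d|)).subset fun y hy => ?_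
  rw [mem_closedBall_zero_iff, pi_norm_le_iff_of_nonneg (abs_nonneg _)]
  intro p
  rw [pi_norm_le_iff_of_nonneg (abs_nonneg _)]
  exact fun q => (abs_le_of_rowNorm_le hd hy p q).trans (le_abs_self _)

lemma convex_rowNorm_lt [Nonempty κ] {d : ℝ} (hd : 0 < d) (t : ℝ) :
    Convex ℝ {y : κ → μ → ℝ | rowNorm d y < t} := by
  intro y hy z hz a b ha hb hab
  simp only [Set.mem_ofPred_eq, rowNorm_lt_iff, div_lt_iff₀ hd] at hy hz ⊢
  intro p
  have h1 : ∑ q, |(a • y + b • z) p q| ≤ a * ∑ q, |y p q| + b * ∑ q, |z p q| := by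
    rw [Finset.mul_sum, Finset.mul_sum, ← Finset.sum_add_distrib]
    refine Finset.sum_le_sum fun q _ => ?_
    have := abs_add_le (a * y p q) (b * z p q)
    rwa [abs_mul, abs_mul, abs_of_nonneg ha, abs_of_nonneg hb] at this
  refine h1.trans_lt ?_
  have h2 := convex_Iio (𝕜 := ℝ) (t * d) (hy p) (hz p) ha hb hab
  simpa using h2

variable {G : κ → μ → Matrix n n ℂ} {D : ℝ}

omit [Fintype n] in
lemma frameOp_apply (y : κ → μ → ℝ) :
    frameOp G D y = ∑ p, ∑ q, (y p q / D) • G p q := rfl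

omit [Fintype n] in
lemma convex_le_frameOp (J : Matrix n n ℂ) : Convex ℝ {y | J ≤ frameOp G D y} := by
  intro y hy z hz a b ha hb hab
  rw [Set.mem_ofPred_eq, Matrix.le_iff] at *
  have : frameOp G D (a • y + b • z) - J = a • (frameOp G D y - J) + b • (frameOp G D z - J) := by
    rw [map_add, map_smul, map_smul, smul_sub, smul_sub, sub_add_sub_comm, ← add_smul, hab,
      one_smul]
  rw [this]
  exact (hy.smul ha).add (hz.smul hb)

namespace IsHermitianFrame

lemma frameOp_isHermitian (hG : IsHermitianFrame G D) (y : κ → μ → ℝ) : (frameOp G D y).IsHermitian := by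
  rw [Matrix.IsHermitian, frameOp_apply]
  simp only [Matrix.conjTranspose_sum, Matrix.conjTranspose_smul, star_trivial,
    (hG.isHermitian _ _).eq]

lemma frameOp_re_trace (hG : IsHermitianFrame G D) {M : Matrix n n ℂ} (hM : M.IsHermitian) :
    frameOp G D (fun p q => (G p q * M).trace.re) = M := by
  have hD : (D : ℂ) ≠ 0 := by exact_mod_cast hG.pos.ne'
  have h := congrArg (fun X => (D : ℂ)⁻¹ • X) (hG.complete M)
  simp only [smul_smul, inv_mul_cancel₀ hD, one_smul] at h
  refine Eq.trans ?_ h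
  rw [frameOp_apply, Finset.smul_sum]
  refine Finset.sum_congr rfl fun p _ => ?_
  rw [Finset.smul_sum]
  refine Finset.sum_congr rfl fun q _ => ?_
  rw [← ofReal_re_trace_mul (hG.isHermitian p q) hM, smul_smul,
    ← Complex.ofReal_inv, ← Complex.ofReal_mul, Complex.coe_smul, div_eq_inv_mul,
    Complex.ofReal_re]

lemma trace_mul_frameOp (hG : IsHermitianFrame G D) (p : κ) (q : μ) (y : κ → μ → ℝ) :
    (G p q * frameOp G D y).trace = y p q := by
  have hD : (D : ℂ) ≠ 0 := by exact_mod_cast hG.pos.ne'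
  simp only [frameOp_apply, Matrix.mul_sum, Matrix.trace_sum, Matrix.mul_smul, Matrix.trace_smul]
  rw [Finset.sum_eq_single p _ (by simp), Finset.sum_eq_single q _ (by simp)]
  · rw [hG.trace_self, Complex.real_smul]
    push_cast
    field_simp
  · intro q' _ h
    rw [hG.trace_of_ne _ _ _ _ (by simpa using h.symm), smul_zero]
  · intro p' _ h
    refine Finset.sum_eq_zero fun q' _ => ?_
    rw [hG.trace_of_ne _ _ _ _ (by simp [h.symm]), smul_zero]

/-- The Loewner condition is an intersection of closed conditions, one for each quadratic form `x†
(Y - J) x`. -/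
lemma isClosed_le_frameOp (hG : IsHermitianFrame G D) {J : Matrix n n ℂ} (hJ : J.IsHermitian) :
    IsClosed {y | J ≤ frameOp G D y} := by
  have hc : Continuous (frameOp G D) := (frameOp G D).continuous_of_finiteDimensional
  have : {y | J ≤ frameOp G D y}
      = ⋂ x : n → ℂ, {y | 0 ≤ star x ⬝ᵥ ((frameOp G D y - J) *ᵥ x)} := by
    ext y
    simp only [Set.mem_ofPred_eq, Set.mem_iInter, Matrix.le_iff,
      Matrix.posSemidef_iff_dotProduct_mulVec, and_iff_right ((hG.frameOp_isHermitian y).sub hJ)]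
  rw [this]
  refine isClosed_iInter fun x => isClosed_le continuous_const ?_
  exact continuous_const.dotProduct ((hc.sub continuous_const).matrix_mulVec continuous_const)

end IsHermitianFrame

omit [Fintype n] in
-- Norm zero would force all coordinates to vanish, so `J ≤ 0`.
lemma rowNorm_pos [Nonempty κ] {d : ℝ} (hd : 0 < d)
    {J : Matrix n n ℂ} (hJ : 0 ≤ J) (hJ0 : J ≠ 0) {y : κ → μ → ℝ}
    (hy : J ≤ frameOp G D y) : 0 < rowNorm d y := by
  by_contra h
  rw [not_lt] at h
  have : y = 0 := by
    ext p q
    have := abs_le_of_rowNorm_le hd h p q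
    rw [zero_mul] at this
    simpa using this
  rw [this, map_zero] at hy
  exact hJ0 (le_antisymm hy hJ)

namespace IsHermitianFrame

lemma exists_isMinOn_rowNorm [Nonempty κ] (hG : IsHermitianFrame G D) {d : ℝ} (hd : 0 < d)
    {J : Matrix n n ℂ} (hJ : J.IsHermitian) :
    ∃ y, J ≤ frameOp G D y ∧ ∀ z, J ≤ frameOp G D z → rowNorm d y ≤ rowNorm d z := by
  -- The coordinates of `J` itself are feasible, so only the compact sublevel set at their norm
  -- matters.
  set y₀ : κ → μ → ℝ := fun p q => (G p q * J).trace.re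
  have h₀ : J ≤ frameOp G D y₀ := (hG.frameOp_re_trace hJ).ge
  have hK : IsCompact ({y : κ → μ → ℝ | rowNorm d y ≤ rowNorm d y₀} ∩
      {y | J ≤ frameOp G D y}) :=
    (isCompact_rowNorm_le hd _).inter_right (hG.isClosed_le_frameOp hJ)
  obtain ⟨y, hy, hmin⟩ := hK.exists_isMinOn ⟨y₀, le_refl (rowNorm d y₀), h₀⟩
    (continuous_rowNorm d).continuousOn
  refine ⟨y, hy.2, fun z hz => ?_⟩
  rcases le_total (rowNorm d z) (rowNorm d y₀) with h | h
  · exact hmin ⟨h, hz⟩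
  · exact le_trans hy.1 h

/-- A linear functional that weakly separates the operators above `J` from the origin is given
by pairing with a positive operator. -/
lemma exists_nonneg_of_bddBelow (hG : IsHermitianFrame G D)
    {J : Matrix n n ℂ} (hJ : J.IsHermitian) (φ : (κ → μ → ℝ) →ₗ[ℝ] ℝ) {s : ℝ}
    (hs : ∀ y, J ≤ frameOp G D y → s ≤ φ y) :
    ∃ w : κ → μ → ℝ, (∀ y, φ y = ∑ p, ∑ q, w p q * y p q) ∧ 0 ≤ ∑ p, ∑ q, w p q • G p q := by
  classical
  set w : κ → μ → ℝ := fun p q => φ (Pi.single p (Pi.single q 1)) with hw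
  have hφ : ∀ y, φ y = ∑ p, ∑ q, w p q * y p q := by
    intro y
    have : y = ∑ p, ∑ q, y p q • (Pi.single p (Pi.single q 1) : κ → μ → ℝ) := by
      ext p q
      simp [Finset.sum_apply, Pi.single_apply, apply_ite, ite_apply]
    conv_lhs => rw [this]
    simp only [map_sum, map_smul, smul_eq_mul, hw, mul_comm]
  refine ⟨w, hφ, ?_⟩
  have hV : (∑ p, ∑ q, w p q • G p q).IsHermitian := by
    rw [Matrix.IsHermitian]
    simp only [Matrix.conjTranspose_sum, Matrix.conjTranspose_smul, star_trivial,
      (hG.isHermitian _ _).eq]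
  rw [Matrix.nonneg_iff_posSemidef]
  refine Matrix.PosSemidef.of_dotProduct_mulVec_nonneg hV fun x => ?_
  rw [dotProduct_mulVec_eq_trace]
  set P := Matrix.vecMulVec x (star x)
  have hP : P.PosSemidef := Matrix.posSemidef_vecMulVec_self_star x
  set y : κ → μ → ℝ := fun p q => (G p q * P).trace.re with hy
  have htr : (P * ∑ p, ∑ q, w p q • G p q).trace = (φ y : ℂ) := by
    rw [hφ, Matrix.mul_sum, Matrix.trace_sum, Complex.ofReal_sum]
    refine Finset.sum_congr rfl fun p _ => ?_
    rw [Matrix.mul_sum, Matrix.trace_sum, Complex.ofReal_sum]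
    refine Finset.sum_congr rfl fun q _ => ?_
    rw [Matrix.mul_smul, Matrix.trace_smul, Matrix.trace_mul_comm, Complex.ofReal_mul,
      hy, ofReal_re_trace_mul (hG.isHermitian p q) hP.isHermitian, Complex.real_smul]
  rw [htr, Complex.zero_le_real]
  set z : κ → μ → ℝ := fun p q => (G p q * J).trace.re
  -- The ray `J + r P` stays above `J`, so `φ` is bounded below along it and its slope `φ y` cannot
  -- be negative.
  have key : ∀ r : ℝ, 0 ≤ r → s ≤ φ z + r * φ y := by
    intro r hr
    have := hs (z + r • y) (by
      rw [map_add, map_smul, hG.frameOp_re_trace hJ, hG.frameOp_re_trace hP.isHermitian,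
        Matrix.le_iff, add_sub_cancel_left]
      exact hP.smul hr)
    simpa using this
  by_contra! hneg
  -- At this `r` the functional would take the value `s - 1`.
  have h1 := key ((φ z - s + 1) / (-φ y)) (div_nonneg (by linarith [key 0 le_rfl]) (by linarith))
  have h2 : (φ z - s + 1) / (-φ y) * φ y = -(φ z - s + 1) := by
    field_simp [hneg.ne]
  linarith

end IsHermitianFrame

/-- The norm dual to `rowNorm` is computed by the row maxima. -/
lemma sum_rowMax_le_one [Nonempty κ] [Nonempty μ] {d t : ℝ} (hd : 0 < d) (ht : 0 < t)
    (w : κ → μ → ℝ)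
    (hw : ∀ y, rowNorm d y < t → ∑ p, ∑ q, w p q / d * y p q < t) :
    ∑ p, Finset.univ.sup' Finset.univ_nonempty (fun q => |w p q|) ≤ 1 := by
  classical
  have hmax : ∀ p, ∃ q, Finset.univ.sup' Finset.univ_nonempty (fun q => |w p q|) = |w p q| := by
    intro p
    obtain ⟨q, -, hq⟩ := Finset.exists_mem_eq_sup' Finset.univ_nonempty (fun q => |w p q|)
    exact ⟨q, hq⟩
  choose m hm using hmax
  simp only [hm]
  set b := ∑ p, |w p (m p)| with hb
  by_contra! h
  -- One entry per row, at the row maximum of `|w|` and with matching sign: every row has norm at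
  -- most `t / b < t`, yet the pairing equals `t`.
  set y : κ → μ → ℝ := fun p => Pi.single (m p) (t / b * d * SignType.sign (w p (m p)))
  have hb0 : 0 < b := by linarith
  have hlt : rowNorm d y < t := by
    rw [rowNorm_lt_iff]
    intro p
    have h1 : ∑ q, |y p q| ≤ t / b * d := by
      rw [Finset.sum_eq_single (m p) (by intro q _ hq; simp [y, hq]) (by simp)]
      simp only [y, Pi.single_eq_same]
      rw [abs_mul, abs_of_pos (by positivity)]
      refine mul_le_of_le_one_right (by positivity) ?_
      rcases SignType.sign (w p (m p)) with _ | _ | _ <;> simp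
    rw [div_lt_iff₀ hd]
    refine h1.trans_lt (mul_lt_mul_of_pos_right ?_ hd)
    exact div_lt_self ht h
  have hsum : ∑ p, ∑ q, w p q / d * y p q = t := by
    have : ∀ p, ∑ q, w p q / d * y p q = t / b * |w p (m p)| := by
      intro p
      rw [Finset.sum_eq_single (m p) (by intro q _ hq; simp [y, hq]) (by simp)]
      simp only [y, Pi.single_eq_same]
      rw [← self_mul_sign (w p (m p))]
      field_simp
    simp only [this]
    rw [← Finset.mul_sum, ← hb]
    field_simp
  exact absurd (hw y hlt) (by rw [hsum]; exact lt_irrefl t)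

/-- Weak duality: `tr[JV] ≤ tr[YV] ≤ ∑ (c - f) tr[GY] / d ≤ ∑ b t ≤ t`. The second inequality uses
`Y ≥ J ≥ 0`, the third `|c - f| ≤ b`. -/
lemma IsHermitianFrame.le_of_feasible (hG : IsHermitianFrame G D) [Nonempty μ]
    {J Y V : Matrix n n ℂ} {d t s : ℝ}
    (hd : 0 < d) (hY : J ≤ Y)
    (ht : ∀ p, (∑ q, ‖(G p q * Y).trace‖) / d ≤ t)
    {b : κ → ℝ} {c f : κ → μ → ℝ} (hb : ∑ p, b p ≤ 1) (hV : 0 ≤ V)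
    (hVle : V ≤ ∑ p, ∑ q, ((c p q - f p q) / d) • G p q)
    (hcf : ∀ p q, c p q + f p q ≤ b p) (hc : ∀ p q, 0 ≤ c p q) (hf : ∀ p q, 0 ≤ f p q)
    (hs : (J * V).trace = (s : ℂ)) (hJ0 : 0 ≤ J) (ht0 : 0 ≤ t) : s ≤ t := by
  have hY0 : 0 ≤ Y := hJ0.trans hY
  have hYH : Y.IsHermitian := (Matrix.nonneg_iff_posSemidef.1 hY0).isHermitian
  have h1 : (s : ℂ) ≤ (Y * V).trace := by
    rw [← hs, ← sub_nonneg, ← Matrix.trace_sub, ← Matrix.sub_mul]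
    exact trace_mul_nonneg_of_nonneg (sub_nonneg.2 hY) hV
  have h2 : (Y * V).trace ≤ (Y * ∑ p, ∑ q, ((c p q - f p q) / d) • G p q).trace := by
    rw [← sub_nonneg, ← Matrix.trace_sub, ← Matrix.mul_sub]
    exact trace_mul_nonneg_of_nonneg hY0 (sub_nonneg.2 hVle)
  have h3 : (Y * ∑ p, ∑ q, ((c p q - f p q) / d) • G p q).trace
      = ((∑ p, ∑ q, (c p q - f p q) / d * (G p q * Y).trace.re : ℝ) : ℂ) := by
    rw [Matrix.mul_sum, Matrix.trace_sum, Complex.ofReal_sum]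
    refine Finset.sum_congr rfl fun p _ => ?_
    rw [Matrix.mul_sum, Matrix.trace_sum, Complex.ofReal_sum]
    refine Finset.sum_congr rfl fun q _ => ?_
    rw [Matrix.mul_smul, Matrix.trace_smul, Matrix.trace_mul_comm, Complex.ofReal_mul,
      ofReal_re_trace_mul (hG.isHermitian p q) hYH, Complex.real_smul]
  have h4 := h1.trans h2
  rw [h3, Complex.real_le_real] at h4
  refine h4.trans ?_
  have hb0 : ∀ p, 0 ≤ b p := fun p =>
    (add_nonneg (hc p (Classical.arbitrary μ)) (hf p _)).trans (hcf p _)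
  calc ∑ p, ∑ q, (c p q - f p q) / d * (G p q * Y).trace.re
      ≤ ∑ p, b p * t := by
        refine Finset.sum_le_sum fun p _ => ?_
        calc ∑ q, (c p q - f p q) / d * (G p q * Y).trace.re
            ≤ ∑ q, b p / d * ‖(G p q * Y).trace‖ := by
              refine Finset.sum_le_sum fun q _ => ?_
              refine (le_abs_self _).trans ?_
              rw [abs_mul, abs_div, abs_of_pos hd]
              have : |c p q - f p q| ≤ b p := by
                rw [abs_le]
                constructor <;> linarith [hc p q, hf p q, hcf p q]
              exact mul_le_mul ((div_le_div_iff_of_pos_right hd).2 this)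
                (Complex.abs_re_le_norm _) (abs_nonneg _) (div_nonneg (hb0 p) hd.le)
          _ = b p * ((∑ q, ‖(G p q * Y).trace‖) / d) := by
              rw [← Finset.mul_sum]; ring
          _ ≤ b p * t := mul_le_mul_of_nonneg_left (ht p) (hb0 p)
    _ = (∑ p, b p) * t := by rw [Finset.sum_mul]
    _ ≤ t := mul_le_of_le_one_left ht0 hb

/-- Strong duality, with attainment on both sides, for the program that minimises the mixed
`(∞, 1)`-norm of the coordinates of an operator above `J`. -/
theorem IsHermitianFrame.strong_duality [Nonempty κ] [Nonempty μ] (hG : IsHermitianFrame G D)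
    {J : Matrix n n ℂ} (hJ : 0 ≤ J) (hJ0 : J ≠ 0) {d : ℝ} (hd : 0 < d) :
    ∃ t : ℝ, 0 < t ∧
      IsLeast {t | ∃ Y, J ≤ Y ∧ ∀ p, (∑ q, ‖(G p q * Y).trace‖) / d ≤ t} t ∧
      IsGreatest {s : ℝ | ∃ (V : Matrix n n ℂ) (b : κ → ℝ) (c f : κ → μ → ℝ),
        ∑ p, b p ≤ 1 ∧ 0 ≤ V ∧ V ≤ ∑ p, ∑ q, ((c p q - f p q) / d) • G p q ∧
        (∀ p q, c p q + f p q ≤ b p) ∧ (∀ p q, 0 ≤ c p q) ∧ (∀ p q, 0 ≤ f p q) ∧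
        (J * V).trace = (s : ℂ)} t := by
  have hJH : J.IsHermitian := (Matrix.nonneg_iff_posSemidef.1 hJ).isHermitian
  obtain ⟨y, hy, hmin⟩ := hG.exists_isMinOn_rowNorm hd hJH
  set t := rowNorm d y with ht_def
  have ht : 0 < t := rowNorm_pos hd hJ hJ0 hy
  have hprimal : ∀ p, (∑ q, ‖(G p q * frameOp G D y).trace‖) / d ≤ t := by
    simp only [hG.trace_mul_frameOp, Complex.norm_real, Real.norm_eq_abs]
    exact rowNorm_le_iff.1 le_rfl
  refine ⟨t, ht, ⟨⟨frameOp G D y, hy, hprimal⟩, ?_⟩, ?_, ?_⟩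
  · rintro r ⟨Y, hJY, hr⟩
    have hYH : Y.IsHermitian := (Matrix.nonneg_iff_posSemidef.1 (hJ.trans hJY)).isHermitian
    have hL := hG.frameOp_re_trace hYH
    refine (hmin _ (hL.symm ▸ hJY)).trans (rowNorm_le_iff.2 fun p => le_trans ?_ (hr p))
    gcongr
    exact Complex.abs_re_le_norm _
  -- By minimality of `t` the open ball of radius `t` contains no feasible point.
  · obtain ⟨φ, s, hφ₁, hφ₂⟩ := geometric_hahn_banach_open (convex_rowNorm_lt hd t)
      (isOpen_lt (continuous_rowNorm d) continuous_const)
      (convex_le_frameOp (G := G) (D := D) J)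
      (Set.disjoint_left.2 fun z (hz : rowNorm d z < t) hz' => (hmin z hz').not_gt hz)
    have hs : 0 < s := by
      have := hφ₁ 0 (by simpa [rowNorm] using ht)
      rwa [map_zero] at this
    set yJ : κ → μ → ℝ := fun p q => (G p q * J).trace.re with hyJ
    have hsJ : s ≤ φ yJ := hφ₂ yJ (hG.frameOp_re_trace hJH).ge
    -- Rescaling by the value at `J`, rather than by the separating level `s`, makes `tr[JV]`
    -- exactly `t`; as `s ≤ φ yJ`, the functional stays below `t` on the ball.
    set k := t / φ yJ with hk
    have hJpos : 0 < φ yJ := hs.trans_le hsJ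
    have hk0 : 0 < k := div_pos ht hJpos
    obtain ⟨w, hw, hV⟩ := hG.exists_nonneg_of_bddBelow hJH (k • φ.toLinearMap) (s := k * s)
      (fun z hz => mul_le_mul_of_nonneg_left (hφ₂ z hz) hk0.le)
    replace hw : ∀ z, k * φ z = ∑ p, ∑ q, w p q * z p q := hw
    have hwd : ∀ p q, d * w p q / d = w p q := fun p q => by field_simp
    have hsum := sum_rowMax_le_one hd ht (fun p q => d * w p q) (fun z hz => by
      simp only [hwd]
      rw [← hw]
      calc k * φ z < k * φ yJ := mul_lt_mul_of_pos_left ((hφ₁ z hz).trans_le hsJ) hk0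
        _ = t := div_mul_cancel₀ _ hJpos.ne')
    -- `hsum` determines `b` as the row maxima of `|d w|`. Taking `c`, `f` as positive and negative
    -- parts makes the upper bound on `V` an equality.
    refine ⟨∑ p, ∑ q, w p q • G p q, _, fun p q => (d * w p q)⁺, fun p q => (d * w p q)⁻,
      hsum, hV, ?_, ?_, fun _ _ => posPart_nonneg _, fun _ _ => negPart_nonneg _, ?_⟩
    · simp only [posPart_sub_negPart, hwd, le_refl]
    · intro p q
      rw [posPart_add_negPart]
      exact Finset.le_sup' (fun q => |d * w p q|) (Finset.mem_univ q)
    · have h1 : t = ∑ p, ∑ q, w p q * yJ p q := by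
        rw [← hw, hk, div_mul_cancel₀ _ hJpos.ne']
      rw [h1, Matrix.mul_sum, Matrix.trace_sum, Complex.ofReal_sum]
      refine Finset.sum_congr rfl fun p _ => ?_
      rw [Matrix.mul_sum, Matrix.trace_sum, Complex.ofReal_sum]
      refine Finset.sum_congr rfl fun q _ => ?_
      rw [Matrix.mul_smul, Matrix.trace_smul, Matrix.trace_mul_comm, Complex.ofReal_mul,
        hyJ, ofReal_re_trace_mul (hG.isHermitian p q) hJH, Complex.real_smul]
  · rintro s ⟨V, b, c, f, hb, hV, hVle, hcf, hc, hf, hs⟩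
    exact hG.le_of_feasible hd hy hprimal hb hV hVle hcf hc hf hs hJ ht.le

end Duality

/-! ### Choi matrices, complete positivity and the channel divergence. -/

section Choi
variable {α β : Type*} [Fintype α] [DecidableEq α]

lemma choi_apply (N : Matrix α α ℂ →ₗ[ℂ] Matrix β β ℂ) (a a' : α) (b b' : β) :
    choi N (a, b) (a', b') = N (Matrix.single a a' 1) b b' := by
  simp only [choi, Matrix.sum_apply, Matrix.kroneckerMap_apply, Matrix.single_apply, ite_and,
    ite_mul, one_mul, zero_mul]
  simp

lemma map_apply_eq_sum_choi (N : Matrix α α ℂ →ₗ[ℂ] Matrix β β ℂ) (M : Matrix α α ℂ)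
    (b b' : β) : N M b b' = ∑ a, ∑ a', M a a' * choi N (a, b) (a', b') := by
  conv_lhs => rw [Matrix.matrix_eq_sum_single M]
  simp only [map_sum, Matrix.sum_apply, choi_apply]
  refine Finset.sum_congr rfl fun a _ => Finset.sum_congr rfl fun a' _ => ?_
  have : Matrix.single a a' (M a a') = M a a' • Matrix.single a a' (1 : ℂ) := by simp
  rw [this, map_smul, Matrix.smul_apply, smul_eq_mul]

/-- The linear map with a given Choi matrix. -/
def ofChoi (Y : Matrix (α × β) (α × β) ℂ) : Matrix α α ℂ →ₗ[ℂ] Matrix β β ℂ where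
  toFun M := Matrix.of fun b b' => ∑ a, ∑ a', M a a' * Y (a, b) (a', b')
  map_add' M M' := by
    ext b b'
    simp [add_mul, Finset.sum_add_distrib]
  map_smul' c M := by
    ext b b'
    simp [mul_assoc, Finset.mul_sum]

lemma choi_ofChoi (Y : Matrix (α × β) (α × β) ℂ) : choi (ofChoi Y) = Y := by
  ext ⟨a, b⟩ ⟨a', b'⟩
  simp [choi_apply, ofChoi, Matrix.single_apply, ite_and]

omit [Fintype α] [DecidableEq α] in
lemma amplify_sum {R ι : Type*} (s : Finset ι) (N : Matrix α α ℂ →ₗ[ℂ] Matrix β β ℂ)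
    (M : ι → Matrix (R × α) (R × α) ℂ) :
    amplify R N (∑ i ∈ s, M i) = ∑ i ∈ s, amplify R N (M i) := by
  ext p q
  have h : (Matrix.of fun a a' => (∑ i ∈ s, M i) (p.1, a) (q.1, a'))
      = ∑ i ∈ s, Matrix.of fun a a' => M i (p.1, a) (q.1, a') := by
    ext a a'
    simp [Matrix.sum_apply]
  rw [amplify, Matrix.of_apply, h, map_sum, Matrix.sum_apply, Matrix.sum_apply]
  rfl

/-- The unnormalised maximally entangled vector. -/
def entangledVec (α : Type*) [DecidableEq α] : α × α → ℂ := fun p => if p.1 = p.2 then 1 else 0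

lemma amplify_entangledVec (N : Matrix α α ℂ →ₗ[ℂ] Matrix β β ℂ) (c : ℝ) :
    amplify α N (Matrix.vecMulVec (c • entangledVec α) (star (c • entangledVec α)))
      = (c * c) • choi N := by
  ext ⟨a, b⟩ ⟨a', b'⟩
  simp only [amplify, Matrix.of_apply, map_apply_eq_sum_choi, Matrix.vecMulVec_apply]
  simp [entangledVec, apply_ite, ite_mul]

lemma trace_choi [Fintype β] (N : Matrix α α ℂ →ₗ[ℂ] Matrix β β ℂ) :
    (choi N).trace = (N 1).trace := by
  simp only [Matrix.trace, Matrix.diag_apply, map_apply_eq_sum_choi, Fintype.sum_prod_type,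
    Matrix.one_apply]
  rw [Finset.sum_comm]
  simp

variable [Fintype β] [DecidableEq β]

/-- The operator on the input that produces the vector `ψ` from a maximally entangled one. -/
def steering {R : Type*} (ψ : R × α → ℂ) : Matrix (R × β) (α × β) ℂ :=
  Matrix.of fun p q => if p.2 = q.2 then ψ (p.1, q.1) else 0

/-- Every pure-state output is a congruence of the Choi matrix, so Loewner inequalities between Choi
matrices pass to all inputs. -/
lemma amplify_vecMulVec {R : Type*} (N : Matrix α α ℂ →ₗ[ℂ] Matrix β β ℂ)
    (ψ : R × α → ℂ) :
    amplify R N (Matrix.vecMulVec ψ (star ψ))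
      = steering (β := β) ψ * choi N * (steering (β := β) ψ)ᴴ := by
  ext ⟨r, b⟩ ⟨r', b'⟩
  have hs : ∀ r b a b', steering (β := β) ψ (r, b) (a, b') = if b = b' then ψ (r, a) else 0 :=
    fun _ _ _ _ => rfl
  simp only [amplify, Matrix.of_apply, map_apply_eq_sum_choi, Matrix.vecMulVec_apply,
    Matrix.mul_apply, hs, Matrix.conjTranspose_apply, Fintype.sum_prod_type, ite_mul,
    zero_mul, Finset.sum_ite_eq, Finset.mem_univ, if_true, apply_ite star, star_zero, mul_ite,
    mul_zero, Pi.star_apply]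
  rw [Finset.sum_comm]
  refine Finset.sum_congr rfl fun a' _ => ?_
  rw [Finset.sum_mul]
  exact Finset.sum_congr rfl fun a _ => by ring

/-- A positive input `P† P` is a sum of rank-one terms given by the rows of `P`, each sent to a
congruence of the Choi matrix. -/
lemma isCompletelyPositive_of_choi {N : Matrix α α ℂ →ₗ[ℂ] Matrix β β ℂ} (h : 0 ≤ choi N) :
    IsCompletelyPositive N := by
  intro k M hM
  obtain ⟨P, rfl⟩ := CStarAlgebra.nonneg_iff_eq_star_mul_self.mp
    (Matrix.nonneg_iff_posSemidef.2 hM)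
  have : star P * P = ∑ i, Matrix.vecMulVec (star (P i)) (star (star (P i))) := by
    ext p q
    simp [Matrix.mul_apply, Matrix.sum_apply, Matrix.vecMulVec_apply, Matrix.star_apply]
  rw [this, amplify_sum]
  refine Matrix.posSemidef_sum _ fun i _ => ?_
  rw [amplify_vecMulVec]
  exact (Matrix.nonneg_iff_posSemidef.1 h).mul_mul_conjTranspose_same _

omit [Fintype β] [DecidableEq β] in
-- The Choi matrix is the output on the entangled vector, once the reference system is relabelled by
-- `Fin k`.
lemma IsCompletelyPositive.choi_nonneg {N : Matrix α α ℂ →ₗ[ℂ] Matrix β β ℂ}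
    (h : IsCompletelyPositive N) : 0 ≤ choi N := by
  set e := Fintype.equivFin α
  have h1 := h (Fintype.card α)
    (Matrix.vecMulVec (fun p => entangledVec α (e.symm p.1, p.2))
      (star fun p => entangledVec α (e.symm p.1, p.2)))
    (Matrix.posSemidef_vecMulVec_self_star _)
  have h2 := h1.submatrix (fun p : α × β => (e p.1, p.2))
  have h3 := amplify_entangledVec N 1
  rw [one_smul, mul_one, one_smul] at h3
  have h4 : choi N = (amplify (Fin (Fintype.card α)) N
      (Matrix.vecMulVec (fun p => entangledVec α (e.symm p.1, p.2))
        (star fun p => entangledVec α (e.symm p.1, p.2)))).submatrix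
        (fun p : α × β => (e p.1, p.2)) (fun p : α × β => (e p.1, p.2)) := by
    rw [← h3]
    ext p q
    simp [amplify, Matrix.submatrix_apply, Matrix.vecMulVec_apply]
  rw [Matrix.nonneg_iff_posSemidef, h4]
  exact h2

lemma maxRelEntropy_le {γ : Type*} [Fintype γ] {ρ σ : Matrix γ γ ℂ} {r : ℝ}
    (h : ρ ≤ ((2 : ℝ) ^ r) • σ) : maxRelEntropy ρ σ ≤ (r : EReal) :=
  sInf_le ⟨r, h, rfl⟩

lemma maxChannelDivergence_le {N E : Matrix α α ℂ →ₗ[ℂ] Matrix β β ℂ} {r : ℝ}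
    (h : choi N ≤ ((2 : ℝ) ^ r) • choi E) : maxChannelDivergence N E ≤ (r : EReal) := by
  refine iSup_le fun ψ => maxRelEntropy_le ?_
  rw [amplify_vecMulVec, amplify_vecMulVec, Matrix.le_iff]
  have := (Matrix.le_iff.1 h).mul_mul_conjTranspose_same (steering (β := β) ψ.1)
  rwa [Matrix.mul_sub, Matrix.sub_mul, Matrix.mul_smul, Matrix.smul_mul] at this

omit [DecidableEq β] in
-- The normalised maximally entangled state already tests the full Choi inequality, up to the
-- positive factor `1 / |α|`.
lemma le_maxChannelDivergence [Nonempty α] {N E : Matrix α α ℂ →ₗ[ℂ] Matrix β β ℂ} {x : EReal}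
    (h : ∀ r : ℝ, choi N ≤ ((2 : ℝ) ^ r) • choi E → x ≤ r) : x ≤ maxChannelDivergence N E := by
  have hc : (0 : ℝ) < Fintype.card α := by exact_mod_cast Fintype.card_pos
  set c : ℝ := (Real.sqrt (Fintype.card α))⁻¹
  have hcc : c * c = (Fintype.card α : ℝ)⁻¹ := by
    rw [← mul_inv, Real.mul_self_sqrt hc.le]
  have hcc0 : 0 < c * c := by rw [hcc]; positivity
  have hψ : star (c • entangledVec α) ⬝ᵥ (c • entangledVec α) = 1 := by
    have : (c : ℂ) * c = (Fintype.card α : ℂ)⁻¹ := by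
      rw [← Complex.ofReal_mul, hcc, Complex.ofReal_inv, Complex.ofReal_natCast]
    have hc' : (Fintype.card α : ℂ) ≠ 0 := by exact_mod_cast hc.ne'
    simp [dotProduct, entangledVec, Fintype.sum_prod_type, this, hc', apply_ite]
  refine le_iSup_of_le ⟨_, hψ⟩ (le_sInf ?_)
  rintro _ ⟨r, hr, rfl⟩
  refine h r ?_
  rw [Set.mem_ofPred_eq, amplify_entangledVec, amplify_entangledVec, smul_comm,
    Matrix.le_iff, ← smul_sub] at hr
  have := hr.smul (inv_nonneg.2 hcc0.le)
  rwa [smul_smul, inv_mul_cancel₀ hcc0.ne', one_smul] at this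

end Choi

/-! ### Mana as a constraint on the Choi matrix, and the concrete frame. -/

lemma log₂_le_zero_iff {x : ℝ} : log₂ x ≤ 0 ↔ x ≤ 1 := by
  unfold log₂
  split_ifs with h
  · exact ⟨fun _ => by linarith, fun _ => bot_le⟩
  · rw [not_le] at h
    rw [← EReal.coe_zero, EReal.coe_le_coe_iff, Real.logb_nonpos_iff (by norm_num) h]

variable (A B : QuditSystem)

/-- Wigner functions of outputs in terms of the Choi matrix. -/
lemma trace_kronecker_mul_choi (E : A.Op →ₗ[ℂ] B.Op) (u : A.Phase) (v : B.Phase) :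
    ((phasePoint A u ⊗ₖ phasePoint B v) * choi E).trace
      = (phasePoint B v * E (phasePoint A (reflect A u))).trace := by
  simp only [Matrix.trace, Matrix.diag_apply, Matrix.mul_apply, map_apply_eq_sum_choi,
    Fintype.sum_prod_type, Matrix.kroneckerMap_apply, ← phasePoint_transpose,
    Matrix.transpose_apply, Finset.mul_sum]
  rw [Finset.sum_comm]
  refine Finset.sum_congr rfl fun b _ => ?_
  conv_lhs => rw [Finset.sum_comm]
  conv_rhs => rw [Finset.sum_comm]
  refine Finset.sum_congr rfl fun a' _ => ?_
  conv_rhs => rw [Finset.sum_comm]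
  exact Finset.sum_congr rfl fun a _ => Finset.sum_congr rfl fun b' _ => by ring

/-- The Choi matrix brings in the transpose of `A_u`, which is the point operator at the reflected
point; reflection is a bijection, so a condition over all `u` is unaffected. -/
lemma mana_le_zero_iff (E : A.Op →ₗ[ℂ] B.Op) :
    mana A B E ≤ 0 ↔ ∀ u : A.Phase, (∑ v : B.Phase,
      ‖((phasePoint A u ⊗ₖ phasePoint B v) * choi E).trace‖) / (B.hilbertDim : ℝ) ≤ 1 := by
  rw [mana, log₂_le_zero_iff, Finset.sup'_le_iff]
  simp only [Finset.mem_univ, true_implies, trace_kronecker_mul_choi, wignerTraceNorm, wigner,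
    norm_div, Complex.norm_natCast, Finset.sum_div]
  exact (reflect A).surjective.forall

lemma sum_sum_comm {ι₁ ι₂ ι₃ ι₄ : Type*} [Fintype ι₁] [Fintype ι₂] [Fintype ι₃] [Fintype ι₄]
    (f : ι₁ → ι₂ → ι₃ → ι₄ → ℂ) :
    ∑ u, ∑ v, ∑ k, ∑ l, f u v k l = ∑ k, ∑ l, ∑ u, ∑ v, f u v k l := by
  calc ∑ u, ∑ v, ∑ k, ∑ l, f u v k l
      = ∑ u, ∑ k, ∑ v, ∑ l, f u v k l := Finset.sum_congr rfl fun _ _ => Finset.sum_comm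
    _ = ∑ k, ∑ u, ∑ v, ∑ l, f u v k l := Finset.sum_comm
    _ = ∑ k, ∑ l, ∑ u, ∑ v, f u v k l := Finset.sum_congr rfl fun _ _ =>
        (Finset.sum_congr rfl fun _ _ => Finset.sum_comm).trans Finset.sum_comm

/-- Completeness holds because `∑ A_u ⊗ A_u` over the phase space is a multiple of the swap
operator. -/
lemma isHermitianFrame_phasePoint :
    IsHermitianFrame (fun (u : A.Phase) (v : B.Phase) => phasePoint A u ⊗ₖ phasePoint B v)
      ((A.hilbertDim : ℝ) * B.hilbertDim) where
  pos := by
    have hA := hilbertDim_pos A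
    have hB := hilbertDim_pos B
    positivity
  isHermitian u v := by
    rw [Matrix.IsHermitian, Matrix.conjTranspose_kronecker, (phasePoint_isHermitian A u).eq,
      (phasePoint_isHermitian B v).eq]
  trace_self u v := by
    simp [← Matrix.mul_kronecker_mul, Matrix.trace_kronecker, trace_phasePoint_mul_phasePoint]
  trace_of_ne u v u' v' h := by
    rw [← Matrix.mul_kronecker_mul, Matrix.trace_kronecker, trace_phasePoint_mul_phasePoint,
      trace_phasePoint_mul_phasePoint, ite_zero_mul_ite_zero, if_neg]
    rintro ⟨rfl, rfl⟩
    exact h rfl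
  complete M := by
    have key : ∀ p q k l : A.Basis × B.Basis, ∑ u, ∑ v,
        (phasePoint A u ⊗ₖ phasePoint B v) k l * (phasePoint A u ⊗ₖ phasePoint B v) p q
        = if k = q ∧ l = p then (A.hilbertDim : ℂ) * B.hilbertDim else 0 := by
      intro p q k l
      have : ∀ u v, (phasePoint A u ⊗ₖ phasePoint B v) k l *
          (phasePoint A u ⊗ₖ phasePoint B v) p q
          = (phasePoint A u k.1 l.1 * phasePoint A u p.1 q.1) *
            (phasePoint B v k.2 l.2 * phasePoint B v p.2 q.2) := by
        intro u v
        simp only [Matrix.kroneckerMap_apply]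
        ring
      simp only [this, ← Finset.mul_sum, ← Finset.sum_mul, sum_phasePoint_mul_phasePoint]
      rw [ite_zero_mul_ite_zero]
      refine if_congr ?_ rfl rfl
      simp only [Prod.ext_iff]
      tauto
    ext p q
    simp only [Matrix.sum_apply, Matrix.smul_apply, smul_eq_mul, Matrix.trace, Matrix.diag_apply,
      Matrix.mul_apply, Finset.sum_mul]
    calc ∑ u, ∑ v, ∑ k, ∑ l, (phasePoint A u ⊗ₖ phasePoint B v) k l * M l k *
          (phasePoint A u ⊗ₖ phasePoint B v) p q
        = ∑ k, ∑ l, (∑ u, ∑ v, (phasePoint A u ⊗ₖ phasePoint B v) k l *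
          (phasePoint A u ⊗ₖ phasePoint B v) p q) * M l k := by
          simp only [Finset.sum_mul]
          rw [sum_sum_comm]
          simp only [mul_right_comm]
      _ = _ := by
          simp only [key]
          simp [ite_and]

end QuditMagic

theorem mainTheorem6 (A B : QuditMagic.QuditSystem) (N : A.Op →ₗ[ℂ] B.Op)
    (hN : QuditMagic.IsChannel N) :
    ∃ t : ℝ, 0 < t ∧
      (∃ E ∈ QuditMagic.subMagicMaps A B,
        QuditMagic.maxChannelDivergence N E = QuditMagic.maxThauma A B N) ∧
      QuditMagic.maxThauma A B N = (Real.logb 2 t : EReal) ∧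
      IsLeast (QuditMagic.primalValues A B N) t ∧
      IsGreatest (QuditMagic.dualValues A B N) t := by
  open QuditMagic in
  have hJ : 0 ≤ choi N := hN.1.choi_nonneg
  -- Trace preservation gives `tr J^N = tr 1 = d_A`, which is nonzero.
  have hJ0 : choi N ≠ 0 := by
    intro h
    have h1 := trace_choi N
    rw [h, hN.2, Matrix.trace_zero, Matrix.trace_one] at h1
    exact Fintype.card_ne_zero (by exact_mod_cast h1.symm)
  have hd : (0 : ℝ) < B.hilbertDim := by exact_mod_cast hilbertDim_pos B
  obtain ⟨t, ht, hleast, hgreatest⟩ :=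
    (isHermitianFrame_phasePoint A B).strong_duality hJ hJ0 hd
  have hlow : (Real.logb 2 t : EReal) ≤ maxThauma A B N := by
    refine le_iInf fun E => le_maxChannelDivergence fun r hr => ?_
    have hE := (mana_le_zero_iff A B E.1).1 E.2.2
    rw [EReal.coe_le_coe_iff, Real.logb_le_iff_le_rpow (by norm_num) ht]
    -- `2 ^ r J^E` is primal feasible with value `2 ^ r`, by homogeneity of the row constraint.
    refine hleast.2 ⟨_, hr, fun u => ?_⟩
    have h2 : (0 : ℝ) < 2 ^ r := by positivity
    simp only [Matrix.mul_smul, Matrix.trace_smul, norm_smul, Real.norm_of_nonneg h2.le,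
      ← Finset.mul_sum, mul_div_assoc]
    exact mul_le_of_le_one_right h2.le (hE u)
  obtain ⟨Y, hY, hYt⟩ := hleast.1
  -- An optimal `Y`, normalised to row bound `1`, is the Choi matrix of an optimal map; it is
  -- positive because `Y ≥ J ≥ 0`.
  set E := ofChoi (t⁻¹ • Y)
  have hEc : choi E = t⁻¹ • Y := choi_ofChoi _
  have hE : E ∈ subMagicMaps A B := by
    constructor
    · refine isCompletelyPositive_of_choi ?_
      rw [hEc, Matrix.nonneg_iff_posSemidef]
      exact (Matrix.nonneg_iff_posSemidef.1 (hJ.trans hY)).smul (inv_nonneg.2 ht.le)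
    · rw [mana_le_zero_iff, hEc]
      intro u
      simp only [Matrix.mul_smul, Matrix.trace_smul, norm_smul,
        Real.norm_of_nonneg (inv_nonneg.2 ht.le), ← Finset.mul_sum, mul_div_assoc]
      rw [inv_mul_le_iff₀ ht, mul_one]
      exact hYt u
  have hup : maxChannelDivergence N E ≤ (Real.logb 2 t : EReal) := by
    refine maxChannelDivergence_le ?_
    rwa [Real.rpow_logb (by norm_num) (by norm_num) ht, hEc, smul_smul,
      mul_inv_cancel₀ ht.ne', one_smul]
  have hle : maxThauma A B N ≤ maxChannelDivergence N E := iInf_le_of_le ⟨E, hE⟩ le_rfl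
  exact ⟨t, ht, ⟨E, hE, le_antisymm (hup.trans hlow) hle⟩,
    le_antisymm (hle.trans hup) hlow, hleast, hgreatest⟩
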